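/- A metric-measure space $X=(X,d,\mu)$ is a compact metric space $(X,d)$ with a finite Borel measure $\mu$; $B_r(x)=\{y: d(x,y)<r\}$ and $\operatorname{supp}(\mu)$ is the set of points all of whose neighbourhoods have positive measure. For $\rho>0$ the $\rho$-Laplacian is the bounded operator on $L^2(X,\mu)$ $$\Delta^\rho_X u(x)=\frac1{\rho^2\mu(B_\rho(x))}\int_{B_\rho(x)}\bigl(u(x)-u(y)\bigr)\,d\mu(y).$$ The essential spectrum of $\Delta^\rho_X$ is the part of the spectrum that does not consist of isolated eigenvalues of finite multiplicity, and $\lambda_\infty$ is its infimum ($\lambda_\infty=\infty$ if it is empty). For $R>0$ let $\#^\rho_X(R)$ be the number of eigenvalues of $\Delta^\rho_X$ in $[0,R]$, counted with multiplicities, with $\#^\rho_X(R)=\infty$ if $R\ge\lambda_\infty$. Let $N_X(r)$ be the maximum number of points in a subset of $X$ any two distinct points of which are at distance at least $r$. For $\Lambda>0$ and $0<\varepsilon\le r/2$, the space $X$ satisfies $BIV(\Lambda,r,\varepsilon)$ if for all $x,y\in\operatorname{supp}(\mu)$ with $d(x,y)\le r+\varepsilon$, $$\mu(B_r(x)\cap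 B_r(y))\ge\Lambda^{-1}\mu(B_{r+\varepsilon}(x)).$$ **Theorem 7.1.** For every $\Lambda\ge1$ there exists $c=c(\Lambda)>0$ such that the following holds. Let $\rho>0$ and let $X$ be a metric-measure space that satisfies $BIV(\Lambda,\tfrac56\rho,\tfrac5{12}\rho)$ and the restricted doubling condition $$\mu(B_{5\rho/3}(x))\le\Lambda\,\mu(B_{5\rho/6}(x))\qquad\text{for all }x\in\operatorname{supp}(\mu).$$ Then $$\#^\rho_X(c\rho^{-2})\le N_X(\rho/24).$$ -/

import Mathlib

open MeasureTheory Metric Set Filter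
open scoped ENNReal Topology

noncomputable section

namespace MMLaplacian

lemma integrable_Lp {Y : Type*} [MeasurableSpace Y] (μ : Measure Y) [IsFiniteMeasure μ]
    (u : Lp ℝ 2 μ) : Integrable u μ :=
  memLp_one_iff_integrable.1 ((Lp.memLp u).mono_exponent (by norm_num))

variable {X : Type*} [MetricSpace X] [MeasurableSpace X]

/-- The `ρ`-Laplacian applied to a function `u`, pointwise:
`(ρ² μ(B_ρ(x)))⁻¹ ∫_{B_ρ(x)} (u(x) - u(y)) dμ(y)`, where `B_ρ(x)` is the open ball. -/
def rhoLapFun (μ : Measure X) (ρ : ℝ) (u : X → ℝ) (x : X) : ℝ :=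
  (ρ ^ 2 * μ.real (ball x ρ))⁻¹ * ∫ y in ball x ρ, (u x - u y) ∂μ

section Construction

variable (μ : Measure X) (ρ : ℝ)

lemma rhoLapFun_smul (a : ℝ) (u : Lp ℝ 2 μ) :
    rhoLapFun μ ρ ↑(a • u) =ᵐ[μ] a • rhoLapFun μ ρ u := by
  filter_upwards [Lp.coeFn_smul a u] with x hx
  simp only [Pi.smul_apply, rhoLapFun, smul_eq_mul]
  have h : ∫ y in ball x ρ, ((a • u : Lp ℝ 2 μ) x - (a • u : Lp ℝ 2 μ) y) ∂μ =
      ∫ y in ball x ρ, a * (u x - u y) ∂μ := by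
    refine integral_congr_ae ?_
    filter_upwards [ae_restrict_of_ae (Lp.coeFn_smul a u)] with y hy
    rw [hx, hy]
    simp only [Pi.smul_apply, smul_eq_mul]
    ring
  rw [h, integral_const_mul, mul_left_comm]

variable [IsFiniteMeasure μ]

lemma rhoLapFun_add (u v : Lp ℝ 2 μ) :
    rhoLapFun μ ρ ↑(u + v) =ᵐ[μ] rhoLapFun μ ρ u + rhoLapFun μ ρ v := by
  filter_upwards [Lp.coeFn_add u v] with x hx
  simp only [Pi.add_apply, rhoLapFun]
  rw [← mul_add, ← integral_add]
  · congr 1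
    refine integral_congr_ae ?_
    filter_upwards [ae_restrict_of_ae (Lp.coeFn_add u v)] with y hy
    rw [hx, hy]
    simp only [Pi.add_apply]
    ring
  · exact ((integrable_const _).sub (integrable_Lp μ u)).integrableOn
  · exact ((integrable_const _).sub (integrable_Lp μ v)).integrableOn

variable [CompactSpace X] [BorelSpace X]

/-- On a compact space the measures of the balls of a given radius are bounded away from zero,
up to a null set of centres. -/
lemma exists_inv_le : ∃ C : ℝ, 0 ≤ C ∧ ∀ᵐ x ∂μ, (ρ ^ 2 * μ.real (ball x ρ))⁻¹ ≤ C := by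
  rcases le_or_gt ρ 0 with h | h
  · refine ⟨0, le_rfl, Eventually.of_forall fun x => ?_⟩
    rw [ball_eq_empty.2 h]; simp
  · obtain ⟨t, -, htf, ht⟩ := (isCompact_univ (X := X)).finite_cover_balls (half_pos h)
    have key : ∀ z : X, ∃ C : ℝ, 0 ≤ C ∧
        ∀ᵐ x ∂μ, x ∈ ball z (ρ / 2) → (ρ ^ 2 * μ.real (ball x ρ))⁻¹ ≤ C := by
      intro z
      rcases eq_or_ne (μ (ball z (ρ / 2))) 0 with hz | hz
      · refine ⟨0, le_rfl, ?_⟩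
        have : ∀ᵐ x ∂μ, x ∉ ball z (ρ / 2) := measure_eq_zero_iff_ae_notMem.1 hz
        filter_upwards [this] with x hx hx' using absurd hx' hx
      · have hpos : 0 < μ.real (ball z (ρ / 2)) :=
          ENNReal.toReal_pos hz (measure_ne_top _ _)
        refine ⟨(ρ ^ 2 * μ.real (ball z (ρ / 2)))⁻¹, by positivity,
          Eventually.of_forall fun x hx => ?_⟩
        have hsub : ball z (ρ / 2) ⊆ ball x ρ := by
          intro y hy
          rw [mem_ball] at *
          have := dist_triangle_right y x z
          linarith
        have : μ.real (ball z (ρ / 2)) ≤ μ.real (ball x ρ) := measureReal_mono hsub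
        gcongr
    choose C hC0 hC using key
    refine ⟨∑ z ∈ htf.toFinset, C z, Finset.sum_nonneg fun z _ => hC0 z, ?_⟩
    have hall : ∀ᵐ x ∂μ, ∀ z ∈ t, x ∈ ball z (ρ / 2) → (ρ ^ 2 * μ.real (ball x ρ))⁻¹ ≤ C z :=
      (ae_ball_iff htf.countable).2 fun z _ => hC z
    filter_upwards [hall] with x hx
    obtain ⟨z, hz, hxz⟩ := mem_iUnion₂.1 (ht (mem_univ x))
    exact (hx z hz hxz).trans
      (Finset.single_le_sum (f := C) (fun z _ => hC0 z) (htf.mem_toFinset.2 hz))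

lemma rhoLapFun_stronglyMeasurable {u : X → ℝ} (hu : StronglyMeasurable u) :
    StronglyMeasurable (rhoLapFun μ ρ u) := by
  have hS : MeasurableSet {p : X × X | dist p.2 p.1 < ρ} :=
    (isOpen_lt (continuous_snd.dist continuous_fst) continuous_const).measurableSet
  have h1 : StronglyMeasurable fun x => μ.real (ball x ρ) :=
    (measurable_measure_prodMk_left hS).ennreal_toReal.stronglyMeasurable
  have h2 : StronglyMeasurable fun x => ∫ y in ball x ρ, (u x - u y) ∂μ := by
    have : (fun x => ∫ y in ball x ρ, (u x - u y) ∂μ) = fun x =>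
        ∫ y, {p : X × X | dist p.2 p.1 < ρ}.indicator (fun p => u p.1 - u p.2) (x, y) ∂μ := by
      funext x
      rw [← integral_indicator measurableSet_ball]
      rfl
    rw [this]
    exact (((hu.comp_measurable measurable_fst).sub
      (hu.comp_measurable measurable_snd)).indicator hS).integral_prod_right'
  exact ((stronglyMeasurable_const.mul h1).measurable.inv.stronglyMeasurable).mul h2

/-- The `ρ`-Laplacian of `u ∈ L²` is dominated a.e. by an `L²` function, with a linear bound. -/
lemma exists_dominating : ∃ K : ℝ, ∀ u : Lp ℝ 2 μ, ∃ v : Lp ℝ 2 μ,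
    (∀ᵐ x ∂μ, ‖rhoLapFun μ ρ u x‖ ≤ ‖v x‖) ∧ ‖v‖ ≤ K * ‖u‖ := by
  obtain ⟨C, hC0, hC⟩ := exists_inv_le μ ρ
  let one : Lp ℝ 2 μ := Lp.const 2 μ 1
  refine ⟨C * (μ.real univ + ‖one‖ * ‖one‖), fun u => ?_⟩
  have hone : ∀ᵐ x ∂μ, one x = 1 := Lp.coeFn_const 2 μ (1 : ℝ)
  have hI : ∫ y, |u y| ∂μ ≤ ‖one‖ * ‖u‖ := by
    have h1 : inner ℝ one |u| = ∫ y, |u y| ∂μ := by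
      rw [L2.inner_def]
      refine integral_congr_ae ?_
      filter_upwards [hone, Lp.coeFn_abs u] with x h1 h2
      simp [h1, h2]
    rw [← h1, ← norm_abs_eq_norm u]
    exact real_inner_le_norm _ _
  have hI0 : 0 ≤ ∫ y, |u y| ∂μ := integral_nonneg fun y => abs_nonneg _
  refine ⟨C • (μ.real univ • |u| + (∫ y, |u y| ∂μ) • one), ?_, ?_⟩
  · filter_upwards [hC, hone, Lp.coeFn_abs u,
      Lp.coeFn_smul C (μ.real univ • |u| + (∫ y, |u y| ∂μ) • one),
      Lp.coeFn_add (μ.real univ • |u|) ((∫ y, |u y| ∂μ) • one),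
      Lp.coeFn_smul (μ.real univ) |u|, Lp.coeFn_smul (∫ y, |u y| ∂μ) one]
      with x hx h1 h2 h3 h4 h5 h6
    have hv : (C • (μ.real univ • |u| + (∫ y, |u y| ∂μ) • one) : Lp ℝ 2 μ) x
        = C * (μ.real univ * |u x| + ∫ y, |u y| ∂μ) := by
      rw [h3, Pi.smul_apply, h4, Pi.add_apply, h5, h6, Pi.smul_apply, Pi.smul_apply, h1, h2]
      simp
    have hint : Integrable (fun y => |u x| + |u y|) μ :=
      (integrable_const _).add (integrable_Lp μ u).abs
    have hb : |∫ y in ball x ρ, (u x - u y) ∂μ| ≤ μ.real univ * |u x| + ∫ y, |u y| ∂μ := by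
      calc |∫ y in ball x ρ, (u x - u y) ∂μ|
          ≤ ∫ y in ball x ρ, |u x - u y| ∂μ := abs_integral_le_integral_abs
        _ ≤ ∫ y in ball x ρ, (|u x| + |u y|) ∂μ := by
            refine integral_mono ?_ hint.integrableOn fun y => abs_sub _ _
            exact (((integrable_const _).sub (integrable_Lp μ u)).integrableOn).abs
        _ ≤ ∫ y, (|u x| + |u y|) ∂μ :=
            setIntegral_le_integral hint (Eventually.of_forall fun y => by positivity)
        _ = μ.real univ * |u x| + ∫ y, |u y| ∂μ := by
            rw [integral_add (integrable_const _) (integrable_Lp μ u).abs]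
            simp
    have hinv : 0 ≤ (ρ ^ 2 * μ.real (ball x ρ))⁻¹ := by positivity
    rw [hv, rhoLapFun, Real.norm_eq_abs, Real.norm_eq_abs, abs_mul, abs_of_nonneg hinv]
    exact (mul_le_mul hx hb (abs_nonneg _) hC0).trans (le_abs_self _)
  · have hM : (0 : ℝ) ≤ μ.real univ := by positivity
    calc ‖C • (μ.real univ • |u| + (∫ y, |u y| ∂μ) • one)‖
        ≤ C * (μ.real univ * ‖u‖ + (∫ y, |u y| ∂μ) * ‖one‖) := by
          rw [norm_smul, Real.norm_of_nonneg hC0]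
          gcongr
          refine (norm_add_le _ _).trans ?_
          rw [norm_smul, norm_smul, Real.norm_of_nonneg hM, Real.norm_of_nonneg hI0,
            norm_abs_eq_norm]
      _ ≤ C * (μ.real univ * ‖u‖ + (‖one‖ * ‖u‖) * ‖one‖) := by gcongr
      _ = _ := by ring

lemma rhoLapFun_memLp (u : Lp ℝ 2 μ) : MemLp (rhoLapFun μ ρ u) 2 μ := by
  obtain ⟨K, hK⟩ := exists_dominating μ ρ
  obtain ⟨v, hv, -⟩ := hK u
  exact (Lp.memLp v).of_le
    (rhoLapFun_stronglyMeasurable μ ρ (Lp.stronglyMeasurable u)).aestronglyMeasurable hv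

/-- The `ρ`-Laplacian as a linear map of `L²(X, μ)`. -/
def rhoLaplacianₗ : Lp ℝ 2 μ →ₗ[ℝ] Lp ℝ 2 μ where
  toFun u := (rhoLapFun_memLp μ ρ u).toLp
  map_add' u v := by
    exact (MemLp.toLp_congr _ ((rhoLapFun_memLp μ ρ u).add (rhoLapFun_memLp μ ρ v))
      (rhoLapFun_add μ ρ u v)).trans
      (MemLp.toLp_add (rhoLapFun_memLp μ ρ u) (rhoLapFun_memLp μ ρ v))
  map_smul' a u := by
    exact (MemLp.toLp_congr _ ((rhoLapFun_memLp μ ρ u).const_smul a)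
      (rhoLapFun_smul μ ρ a u)).trans (MemLp.toLp_const_smul a (rhoLapFun_memLp μ ρ u))

lemma rhoLaplacian_bound : ∃ K : ℝ, ∀ u, ‖rhoLaplacianₗ μ ρ u‖ ≤ K * ‖u‖ := by
  obtain ⟨K, hK⟩ := exists_dominating μ ρ
  refine ⟨K, fun u => ?_⟩
  obtain ⟨v, hv, hvK⟩ := hK u
  refine (Lp.norm_le_norm_of_ae_le ?_).trans hvK
  filter_upwards [hv, (rhoLapFun_memLp μ ρ u).coeFn_toLp] with x h1 h2
  exact (congrArg norm h2).le.trans h1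

/-- The `ρ`-Laplacian `Δ^ρ_X` as a bounded operator on the real Hilbert space `L²(X, μ)`. -/
def rhoLaplacian : Lp ℝ 2 μ →L[ℝ] Lp ℝ 2 μ :=
  (rhoLaplacianₗ μ ρ).mkContinuousOfExistsBound (rhoLaplacian_bound μ ρ)

lemma rhoLaplacian_coeFn (u : Lp ℝ 2 μ) : rhoLaplacian μ ρ u =ᵐ[μ] rhoLapFun μ ρ u :=
  (rhoLapFun_memLp μ ρ u).coeFn_toLp

end Construction

section Spectrum

variable {H : Type*} [NormedAddCommGroup H] [NormedSpace ℝ H]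

/-- The eigenspace of `T` for the value `t` (the zero subspace if `t` is not an eigenvalue). -/
def eigenspace (T : H →L[ℝ] H) (t : ℝ) : Submodule ℝ H :=
  Module.End.eigenspace (T : H →ₗ[ℝ] H) t

/-- The multiplicity of `t` as an eigenvalue of `T`: the dimension of the eigenspace in `ℕ∞`
(`0` if `t` is not an eigenvalue). -/
def eigenMultiplicity (T : H →L[ℝ] H) (t : ℝ) : ℕ∞ :=
  Cardinal.toENat (Module.rank ℝ (eigenspace T t))

/-- The discrete spectrum: the isolated points of the spectrum that are eigenvalues of finite
multiplicity. -/
def discreteSpectrum (T : H →L[ℝ] H) : Set ℝ :=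
  {t | t ∈ spectrum ℝ T ∧ (∃ ε > 0, ∀ s ∈ spectrum ℝ T, |s - t| < ε → s = t) ∧
    eigenMultiplicity T t ≠ 0 ∧ eigenMultiplicity T t ≠ ⊤}

/-- The essential spectrum: everything in the spectrum outside the discrete spectrum. -/
def essentialSpectrum (T : H →L[ℝ] H) : Set ℝ :=
  spectrum ℝ T \ discreteSpectrum T

/-- `λ_∞`: the infimum of the essential spectrum, equal to `⊤` if the essential spectrum is empty. -/
def lambdaInfty (T : H →L[ℝ] H) : EReal :=
  ⨅ t ∈ essentialSpectrum T, (t : EReal)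

open Classical in
/-- The number of eigenvalues of `T` in `[0, R]` counted with multiplicities, with the convention
that it is infinite if `R` is at least the infimum `λ_∞` of the essential spectrum.
With `λ_k` denoting the `k`-th smallest eigenvalue below `λ_∞`, and `λ_k = λ_∞` once these
are exhausted, this is `sup {k | λ_k ≤ R}` for a nonnegative self-adjoint `T`. -/
def eigenvalueCount (T : H →L[ℝ] H) (R : ℝ) : ℕ∞ :=
  if lambdaInfty T ≤ (R : EReal) then ⊤
  else ⨆ F : {F : Finset ℝ // (F : Set ℝ) ⊆ Icc 0 R}, ∑ t ∈ F.1, eigenMultiplicity T t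

end Spectrum

/-- The packing number `N_X(r)`: the largest cardinality of a subset of `X` any two distinct points
of which are at distance at least `r`. -/
def packNumber (X : Type*) [MetricSpace X] (r : ℝ) : ℕ∞ :=
  ⨆ S : {S : Set X // S.Pairwise fun x y => r ≤ dist x y}, S.1.encard

/-- The ball intersection volume condition with parameters `Λ`, `ρ`, `ε`
(used for `Λ > 0` and `0 < ε ≤ ρ / 2`). -/
def BIV (μ : Measure X) (Λ ρ ε : ℝ) : Prop :=
  ∀ x ∈ μ.support, ∀ y ∈ μ.support, dist x y ≤ ρ + ε →
    Λ⁻¹ * μ.real (ball x (ρ + ε)) ≤ μ.real (ball x ρ ∩ ball y ρ)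

end MMLaplacian

end

/-
The operator `T = Δ^ρ_X` is symmetric for the inner product `B(u, v) = ∫ μ(B_ρ(x)) u v dμ`, which
is equivalent to that of `L²`, and `B(Tu, u) = (2ρ²)⁻¹ ∬_{d(x,y)<ρ} (u(x) - u(y))²`. Applied with
`x = y`, the condition `BIV` compares `μ(B_{5ρ/4}(x))` with `μ(B_{5ρ/6}(x))`. Let `S` be a maximal
`ρ/24`-separated subset of the support. Every ball `B_ρ(y)` centred in the support lies between
`B_{ρ-ρ/24}(x)` and `B_{ρ+ρ/24}(x)` for some `x ∈ S`, so for `u` with mean zero on the inner balls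
the variance inequality gives `B(u, u) ≤ 2Λρ² B(Tu, u)`. These `u` form a subspace of codimension
at most `|S|`, hence `T` has at most `|S|` eigenvalues below `(2Λρ²)⁻¹`. For `t` below this bound
`T - t` is coercive on that subspace, so it is surjective once it is injective: the spectrum
below `(2Λρ²)⁻¹` consists of eigenvalues, and `λ_∞ ≥ (2Λρ²)⁻¹`.
-/

namespace MMLaplacian

lemma surjective_of_injective_of_sup_map_eq_top {K V : Type*} [DivisionRing K] [AddCommGroup V]
    [Module K V] {A : V →ₗ[K] V} {E F : Submodule K V} [FiniteDimensional K E]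
    (hA : Function.Injective A) (hEF : Disjoint E F) (hsup : E ⊔ F.map A = ⊤) :
    Function.Surjective A := by
  -- The surjection `q` gives `dim (V ⧸ A(F)) ≤ dim E`, so the injection `p` is onto.
  let q := (F.map A).mkQ ∘ₗ E.subtype
  let p := (F.map A).mkQ ∘ₗ A ∘ₗ E.subtype
  have hq : Function.Surjective q := by
    rw [← LinearMap.range_eq_top, LinearMap.range_comp, Submodule.range_subtype,
      Submodule.map_mkQ_eq_top, sup_comm, hsup]
  have hp : Function.Injective p := by
    refine (injective_iff_map_eq_zero p).2 fun x hx => Subtype.ext ?_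
    obtain ⟨y, hy, hyx⟩ := (Submodule.Quotient.mk_eq_zero _).1 hx
    have hyx' : y = x := hA hyx
    exact Submodule.disjoint_def.1 hEF x x.2 (hyx' ▸ hy)
  have := Module.Finite.of_surjective q hq
  have hp' : Function.Surjective p := by
    refine (LinearMap.injective_iff_surjective_of_finrank_eq_finrank ?_).1 hp
    exact (LinearMap.finrank_le_finrank_of_injective hp).antisymm
      (LinearMap.finrank_le_finrank_of_surjective hq)
  intro y
  obtain ⟨x, hx⟩ := hp' ((F.map A).mkQ y)
  obtain ⟨z, -, hz⟩ := (Submodule.Quotient.eq _).1 hx.symm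
  exact ⟨z + x, by rw [map_add, hz]; exact sub_add_cancel _ _⟩

section NormedSpace

variable {H : Type*} [NormedAddCommGroup H] [NormedSpace ℝ H] {T : H →L[ℝ] H}
  {B : H →L[ℝ] H →L[ℝ] ℝ}

lemma bilin_self_pos (hB : IsCoercive B) {u : H} (hu : u ≠ 0) : 0 < B u u := by
  obtain ⟨C, hC, hCB⟩ := hB
  have hnorm : 0 < ‖u‖ := norm_pos_iff.2 hu
  exact (mul_pos (mul_pos hC hnorm) hnorm).trans_le (hCB u)

lemma bilin_sum_smul_sum {ι : Type*} [Fintype ι] (c : ι → ℝ) {u : ι → H}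
    (hu : Pairwise fun i j => B (u i) (u j) = 0) :
    B (∑ i, c i • u i) (∑ j, u j) = ∑ i, c i * B (u i) (u i) := by
  simp only [map_sum, sum_apply, map_smul, smul_apply, smul_eq_mul]
  rw [Finset.sum_comm]
  exact Finset.sum_congr rfl fun i _ =>
    Finset.sum_eq_single i (fun j _ hji => by rw [hu hji.symm, mul_zero]) (by simp)

lemma bilin_eq_zero_of_eigenvectors (hT : ∀ u v, B (T u) v = B u (T v)) {s t : ℝ} (hst : s ≠ t)
    {u v : H} (hu : T u = s • u) (hv : T v = t • v) : B u v = 0 := by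
  have h := hT u v
  rw [hu, hv, map_smul, map_smul, smul_apply] at h
  exact (mul_eq_mul_right_iff.1 h).resolve_left hst

lemma eigenMultiplicity_eq_finrank (t : ℝ) [FiniteDimensional ℝ (eigenspace T t)] :
    eigenMultiplicity T t = Module.finrank ℝ (eigenspace T t) := by
  rw [eigenMultiplicity, ← Module.finrank_eq_rank, map_natCast]

end NormedSpace

section FormGap

variable {H : Type*} [NormedAddCommGroup H] [InnerProductSpace ℝ H] {E : Submodule ℝ H}
  {A T : H →L[ℝ] H} {B : H →L[ℝ] H →L[ℝ] ℝ} {a δ t : ℝ}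

lemma sup_map_orthogonal_eq_top [CompleteSpace H] [E.HasOrthogonalProjection]
    (hδ : 0 < δ) (hA : ∀ u ∈ Eᗮ, δ * ‖u‖ ^ 2 ≤ inner ℝ (A u) u) :
    E ⊔ Eᗮ.map (A : H →ₗ[ℝ] H) = ⊤ := by
  refine eq_top_iff.2 fun y _ => ?_
  have hcoercive : IsCoercive (((innerSL ℝ).comp A).bilinearComp Eᗮ.subtypeL Eᗮ.subtypeL) :=
    ⟨δ, hδ, fun u => by simpa [sq, mul_assoc] using hA u u.2⟩
  let e := hcoercive.continuousLinearEquivOfBilin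
  let v := e.symm (Eᗮ.orthogonalProjectionOnto y)
  have hv : ∀ w ∈ Eᗮ, inner ℝ (A v) w = inner ℝ y w := fun w hw => by
    have h := hcoercive.continuousLinearEquivOfBilin_apply v ⟨w, hw⟩
    rw [show e v = Eᗮ.orthogonalProjectionOnto y from e.apply_symm_apply _,
      Submodule.inner_orthogonalProjectionOnto_eq_of_mem_right] at h
    exact h.symm
  have hsub : y - A v ∈ Eᗮᗮ := Submodule.mem_orthogonal' .. |>.2 fun w hw => by
    rw [inner_sub_left, hv w hw, sub_self]
  rw [E.orthogonal_orthogonal] at hsub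
  exact Submodule.mem_sup.2 ⟨_, hsub, _, ⟨v, v.2, rfl⟩, sub_add_cancel _ _⟩

lemma eq_zero_of_sum_eigenvectors_mem_orthogonal (hB : IsCoercive B)
    (hT : ∀ u v, B (T u) v = B u (T v)) (hE : ∀ u ∈ Eᗮ, a * B u u ≤ B (T u) u) {F : Finset ℝ}
    (hF : ∀ t ∈ F, t < a) {u : F → H} (hu : ∀ t : F, T (u t) = (t : ℝ) • u t)
    (hsum : ∑ t, u t ∈ Eᗮ) : u = 0 := by
  have horth : Pairwise fun s t => B (u s) (u t) = 0 := fun s t hst =>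
    bilin_eq_zero_of_eigenvectors hT (Subtype.coe_injective.ne hst) (hu s) (hu t)
  have hsq : B (∑ t, u t) (∑ t, u t) = ∑ t, B (u t) (u t) := by
    simpa using bilin_sum_smul_sum (fun _ => 1) horth
  have hTsq : B (T (∑ t, u t)) (∑ t, u t) = ∑ t : F, (t : ℝ) * B (u t) (u t) := by
    rw [map_sum T, Fintype.sum_congr _ _ hu, bilin_sum_smul_sum _ horth]
  by_contra hne
  obtain ⟨s, hs⟩ := Function.ne_iff.1 hne
  have hlt : ∑ t : F, (t : ℝ) * B (u t) (u t) < ∑ t, a * B (u t) (u t) := by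
    refine Finset.sum_lt_sum (fun t _ => ?_) ⟨s, Finset.mem_univ s, ?_⟩
    · rcases eq_or_ne (u t) 0 with h0 | h0
      · simp [h0]
      · exact mul_le_mul_of_nonneg_right (hF t t.2).le (bilin_self_pos hB h0).le
    · exact mul_lt_mul_of_pos_right (hF s s.2) (bilin_self_pos hB hs)
  have hgap := hE _ hsum
  rw [hsq, hTsq, Finset.mul_sum] at hgap
  exact hlt.not_ge hgap

lemma sum_eigenMultiplicity_le_finrank [FiniteDimensional ℝ E] (hB : IsCoercive B)
    (hT : ∀ u v, B (T u) v = B u (T v)) (hE : ∀ u ∈ Eᗮ, a * B u u ≤ B (T u) u) {F : Finset ℝ}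
    (hF : ∀ t ∈ F, t < a) : ∑ t ∈ F, eigenMultiplicity T t ≤ Module.finrank ℝ E := by
  let sum : (∀ t : F, eigenspace T (t : ℝ)) →ₗ[ℝ] H :=
    ∑ t : F, (eigenspace T (t : ℝ)).subtype ∘ₗ LinearMap.proj t
  let Φ := (E.orthogonalProjectionOnto : H →ₗ[ℝ] E) ∘ₗ sum
  have hΦ : Function.Injective Φ := (injective_iff_map_eq_zero Φ).2 fun u hu => by
    have hsum : ∑ t, (u t : H) ∈ Eᗮ := by
      rw [← Submodule.orthogonalProjectionOnto_eq_zero_iff]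
      exact Eq.trans (by simp [Φ, sum]) hu
    have hzero := eq_zero_of_sum_eigenvectors_mem_orthogonal hB hT hE hF
      (fun t => Module.End.mem_eigenspace_iff.1 (u t).2) hsum
    exact funext fun t => Subtype.ext (congrFun hzero t)
  have := FiniteDimensional.of_injective Φ hΦ
  have (t : F) : FiniteDimensional ℝ (eigenspace T (t : ℝ)) :=
    Module.Finite.of_surjective (LinearMap.proj (R := ℝ)
      (φ := fun t : F => eigenspace T (t : ℝ)) t) (LinearMap.proj_surjective t)
  rw [← Finset.sum_coe_sort]
  simp only [eigenMultiplicity_eq_finrank]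
  rw [← Nat.cast_sum, ← Module.finrank_pi_fintype]
  exact_mod_cast LinearMap.finrank_le_finrank_of_injective hΦ

lemma surjective_sub_of_injective_of_lt [CompleteSpace H] [FiniteDimensional ℝ E]
    (hB : IsCoercive B) (hE : ∀ u ∈ Eᗮ, a * B u u ≤ B (T u) u) (ht : t < a)
    (hinj : Function.Injective (T - algebraMap ℝ (H →L[ℝ] H) t)) :
    Function.Surjective (T - algebraMap ℝ (H →L[ℝ] H) t) := by
  let W := hB.continuousLinearEquivOfBilin
  let A : H →L[ℝ] H := (W : H →L[ℝ] H).comp (T - algebraMap ℝ (H →L[ℝ] H) t)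
  have hAinner : ∀ u, inner ℝ (A u) u = B (T u) u - t * B u u := fun u =>
    (hB.continuousLinearEquivOfBilin_apply _ u).trans (by simp [Algebra.algebraMap_eq_smul_one])
  obtain ⟨C, hC, hCB⟩ := hB
  have hcoercive : ∀ u ∈ Eᗮ, (a - t) * C * ‖u‖ ^ 2 ≤ inner ℝ (A u) u := fun u hu => by
    have hlower := mul_le_mul_of_nonneg_left (hCB u) (sub_pos.2 ht).le
    linarith [hAinner u, hE u hu]
  have hA : Function.Surjective A := surjective_of_injective_of_sup_map_eq_top
    (A := (A : H →ₗ[ℝ] H)) (W.injective.comp hinj) E.orthogonal_disjoint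
    (sup_map_orthogonal_eq_top (mul_pos (sub_pos.2 ht) hC) hcoercive)
  exact Function.Surjective.of_comp_left (f := W) hA W.injective

lemma eigenMultiplicity_ne_zero_of_lt [CompleteSpace H] [FiniteDimensional ℝ E] (hB : IsCoercive B)
    (hE : ∀ u ∈ Eᗮ, a * B u u ≤ B (T u) u) (ht : t < a) (hs : t ∈ spectrum ℝ T) :
    eigenMultiplicity T t ≠ 0 := by
  intro hmult
  rw [eigenMultiplicity, Cardinal.toENat_eq_zero, rank_zero_iff,
    Submodule.subsingleton_iff_eq_bot] at hmult
  have hinj : Function.Injective (T - algebraMap ℝ (H →L[ℝ] H) t) :=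
    LinearMap.ker_eq_bot.1 <| by
      rw [← hmult, eigenspace, Module.End.eigenspace_def]
      rfl
  have hunit := ContinuousLinearMap.isUnit_iff_bijective.2
    ⟨hinj, surjective_sub_of_injective_of_lt hB hE ht hinj⟩
  exact spectrum.mem_iff.1 hs (by simpa using hunit.neg)

lemma finite_spectrum_inter_Iio [CompleteSpace H] [FiniteDimensional ℝ E] (hB : IsCoercive B)
    (hT : ∀ u v, B (T u) v = B u (T v)) (hE : ∀ u ∈ Eᗮ, a * B u u ≤ B (T u) u) :
    (spectrum ℝ T ∩ Iio a).Finite := by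
  by_contra hinf
  obtain ⟨F, hF, hcard⟩ := Set.Infinite.exists_subset_card_eq hinf (Module.finrank ℝ E + 1)
  have hle : ∑ _t ∈ F, (1 : ℕ∞) ≤ Module.finrank ℝ E :=
    (Finset.sum_le_sum fun t ht => Order.one_le_iff_ne_zero.2 <|
      eigenMultiplicity_ne_zero_of_lt hB hE (hF ht).2 (hF ht).1).trans
    (sum_eigenMultiplicity_le_finrank hB hT hE fun t ht => (hF ht).2)
  rw [Finset.sum_const, hcard, nsmul_one, Nat.cast_le] at hle
  omega

lemma mem_discreteSpectrum_of_lt [CompleteSpace H] [FiniteDimensional ℝ E] (hB : IsCoercive B)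
    (hT : ∀ u v, B (T u) v = B u (T v)) (hE : ∀ u ∈ Eᗮ, a * B u u ≤ B (T u) u) (ht : t < a)
    (hs : t ∈ spectrum ℝ T) : t ∈ discreteSpectrum T := by
  have hmult : eigenMultiplicity T t ≤ Module.finrank ℝ E := by
    simpa using sum_eigenMultiplicity_le_finrank hB hT hE (F := {t}) (by simpa using ht)
  refine ⟨hs, ?_, eigenMultiplicity_ne_zero_of_lt hB hE ht hs,
    (hmult.trans_lt (ENat.natCast_lt_top _)).ne⟩
  have hfin : ((spectrum ℝ T ∩ Iio a) \ {t}).Finite :=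
    (finite_spectrum_inter_Iio hB hT hE).subset sdiff_subset
  have hnhds : ((spectrum ℝ T ∩ Iio a) \ {t})ᶜ ∩ Iio a ∈ 𝓝 t :=
    inter_mem (hfin.isClosed.isOpen_compl.mem_nhds (by simp)) (Iio_mem_nhds ht)
  obtain ⟨ε, hε, hball⟩ := Metric.mem_nhds_iff.1 hnhds
  refine ⟨ε, hε, fun s hs' hst => ?_⟩
  obtain ⟨hnotMem, hsa⟩ := hball (mem_ball.2 hst)
  by_contra hne
  exact hnotMem ⟨⟨hs', hsa⟩, hne⟩

theorem eigenvalueCount_le_finrank [CompleteSpace H] [FiniteDimensional ℝ E] (hB : IsCoercive B)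
    (hT : ∀ u v, B (T u) v = B u (T v)) (hE : ∀ u ∈ Eᗮ, a * B u u ≤ B (T u) u) {R : ℝ}
    (hR : R < a) : eigenvalueCount T R ≤ Module.finrank ℝ E := by
  have hlambda : (a : EReal) ≤ lambdaInfty T := by
    refine le_iInf₂ fun t ht => le_of_not_gt fun hlt => ht.2 ?_
    exact mem_discreteSpectrum_of_lt hB hT hE (EReal.coe_lt_coe_iff.1 hlt) ht.1
  rw [eigenvalueCount, if_neg (((EReal.coe_lt_coe_iff.2 hR).trans_le hlambda).not_ge)]
  exact iSup_le fun F => sum_eigenMultiplicity_le_finrank hB hT hE fun t ht =>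
    (F.2 ht).2.trans_lt hR

end FormGap

section WeightedForm

variable {α : Type*} [MeasurableSpace α] {μ : Measure α} {w : α → ℝ}

/-- The bounded symmetric bilinear form `(u, v) ↦ ∫ w u v dμ` on `L²(μ)` defined by a weight
`w ∈ L^∞(μ)`. -/
noncomputable def weightedForm (hw : MemLp w ∞ μ) : Lp ℝ 2 μ →L[ℝ] Lp ℝ 2 μ →L[ℝ] ℝ :=
  (innerSL ℝ).comp ((ContinuousLinearMap.mul ℝ ℝ).holderL μ ∞ 2 2 hw.toLp)

lemma weightedForm_apply (hw : MemLp w ∞ μ) (u v : Lp ℝ 2 μ) :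
    weightedForm hw u v = ∫ x, w x * (u x * v x) ∂μ := by
  refine (L2.inner_def _ v).trans (integral_congr_ae ?_)
  filter_upwards [(ContinuousLinearMap.mul ℝ ℝ).coeFn_holder (r := 2) hw.toLp u, hw.coeFn_toLp]
    with x hmul hwx
  change inner ℝ ((ContinuousLinearMap.mul ℝ ℝ).holder 2 hw.toLp u x) (v x) = _
  rw [hmul, hwx]
  simp [mul_comm (v x), mul_assoc]

lemma weightedForm_comm (hw : MemLp w ∞ μ) (u v : Lp ℝ 2 μ) :
    weightedForm hw u v = weightedForm hw v u := by
  simp only [weightedForm_apply, mul_comm (u _)]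

lemma isCoercive_weightedForm (hw : MemLp w ∞ μ) {δ : ℝ} (hδ : 0 < δ) (h : ∀ᵐ x ∂μ, δ ≤ w x) :
    IsCoercive (weightedForm hw) := by
  refine ⟨δ, hδ, fun u => ?_⟩
  have huu : Integrable (fun x => u x * u x) μ := (Lp.memLp u).integrable_mul (Lp.memLp u)
  rw [mul_assoc, ← real_inner_self_eq_norm_mul_norm, L2.inner_def, weightedForm_apply,
    ← integral_const_mul]
  refine integral_mono_ae (huu.const_mul δ) (huu.mul_of_top_right hw) ?_
  filter_upwards [h] with x hx
  exact mul_le_mul_of_nonneg_right hx (mul_self_nonneg (u x))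

end WeightedForm

section Fubini

variable {α β : Type*} [MeasurableSpace α] [MeasurableSpace β]

lemma integral_section_eq {ν : Measure β} {s : Set (α × β)}
    (hs : MeasurableSet s) (F : α × β → ℝ) (x : α) :
    ∫ y, s.indicator F (x, y) ∂ν = ∫ y in Prod.mk x ⁻¹' s, F (x, y) ∂ν :=
  integral_indicator (measurable_prodMk_left hs)

lemma integrable_setIntegral_section {μ : Measure α} {ν : Measure β} [SFinite μ] [SFinite ν]
    {s : Set (α × β)} (hs : MeasurableSet s) {F : α × β → ℝ} (hF : IntegrableOn F s (μ.prod ν)) :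
    Integrable (fun x => ∫ y in Prod.mk x ⁻¹' s, F (x, y) ∂ν) μ := by
  simpa only [integral_section_eq hs] using ((integrable_indicator_iff hs).2 hF).integral_prod_left

lemma setIntegral_prod_eq_integral_section {μ : Measure α} {ν : Measure β} [SFinite μ] [SFinite ν]
    {s : Set (α × β)} (hs : MeasurableSet s) {F : α × β → ℝ} (hF : IntegrableOn F s (μ.prod ν)) :
    ∫ p in s, F p ∂μ.prod ν = ∫ x, ∫ y in Prod.mk x ⁻¹' s, F (x, y) ∂ν ∂μ := by
  rw [← integral_indicator hs, integral_prod _ ((integrable_indicator_iff hs).2 hF)]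
  simp only [integral_section_eq hs]

variable {μ : Measure α} [IsFiniteMeasure μ] {f g : α → ℝ}

lemma memLp_fst_sub_snd (hf : MemLp f 2 μ) :
    MemLp (fun p : α × α => f p.1 - f p.2) 2 (μ.prod μ) :=
  (hf.comp_fst μ).sub (hf.comp_snd μ)

lemma setIntegral_sub_mul_sub {s : Set (α × α)} (hswap : Prod.swap ⁻¹' s = s)
    (hf : MemLp f 2 μ) (hg : MemLp g 2 μ) :
    ∫ p in s, (f p.1 - f p.2) * (g p.1 - g p.2) ∂μ.prod μ =
      2 * ∫ p in s, (f p.1 - f p.2) * g p.1 ∂μ.prod μ := by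
  have hint_fst : Integrable (fun p : α × α => (f p.1 - f p.2) * g p.1) (μ.prod μ) :=
    (memLp_fst_sub_snd hf).integrable_mul (hg.comp_fst μ)
  have hint_snd : Integrable (fun p : α × α => (f p.1 - f p.2) * g p.2) (μ.prod μ) :=
    (memLp_fst_sub_snd hf).integrable_mul (hg.comp_snd μ)
  have hsnd : ∫ p in s, (f p.1 - f p.2) * g p.2 ∂μ.prod μ =
      -∫ p in s, (f p.1 - f p.2) * g p.1 ∂μ.prod μ := by
    rw [← integral_neg, ← Measure.measurePreserving_swap.setIntegral_preimage_emb
      MeasurableEquiv.prodComm.measurableEmbedding, hswap]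
    refine integral_congr_ae (.of_forall fun p => ?_)
    simp only [Prod.fst_swap, Prod.snd_swap]
    ring
  simp only [mul_sub]
  rw [integral_sub hint_fst.integrableOn hint_snd.integrableOn, hsnd]
  ring

lemma measureReal_univ_mul_sq_le (hf : MemLp f 2 μ) (hmean : ∫ x, f x ∂μ = 0) (c : ℝ) :
    μ.real univ * c ^ 2 ≤ ∫ x, (c - f x) ^ 2 ∂μ := by
  have hint : Integrable f μ := hf.integrable (by norm_num)
  have hlin : Integrable (fun x => c ^ 2 - 2 * c * f x) μ :=
    (integrable_const _).sub (hint.const_mul _)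
  calc μ.real univ * c ^ 2 = ∫ x, (c ^ 2 - 2 * c * f x) ∂μ := by
        rw [integral_sub (integrable_const _) (hint.const_mul _), integral_const_mul, hmean]
        simp
    _ ≤ ∫ x, (c - f x) ^ 2 ∂μ :=
        integral_mono hlin ((memLp_const c).sub hf).integrable_sq fun x => by
          linarith [sub_sq c (f x), sq_nonneg (f x)]

end Fubini

section BallForm

variable {X : Type*} [MetricSpace X] [MeasurableSpace X] {μ : Measure X} [IsFiniteMeasure μ]
  {ρ r s Λ : ℝ} {x y : X} {S : Finset X}

lemma measureReal_ball_mul_rhoLapFun {f : X → ℝ} (x : X) :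
    μ.real (ball x ρ) * rhoLapFun μ ρ f x = (ρ ^ 2)⁻¹ * ∫ y in ball x ρ, (f x - f y) ∂μ := by
  rw [rhoLapFun, mul_inv]
  rcases eq_or_ne (μ.real (ball x ρ)) 0 with hzero | hne
  · rw [Measure.restrict_eq_zero.2 ((measureReal_eq_zero_iff).1 hzero)]
    simp
  · field_simp

lemma measureReal_ball_mul_sq_le (hΛ : 0 ≤ Λ) (hxy : dist y x ≤ r)
    (hvol : μ.real (ball x (ρ + r)) ≤ Λ * μ.real (ball x (ρ - r))) {f : X → ℝ} (hf : MemLp f 2 μ)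
    (hmean : ∫ z in ball x (ρ - r), f z ∂μ = 0) (c : ℝ) :
    μ.real (ball y ρ) * c ^ 2 ≤ Λ * ∫ z in ball y ρ, (c - f z) ^ 2 ∂μ := by
  have houter : ball y ρ ⊆ ball x (ρ + r) := ball_subset_ball' (by linarith)
  have hinner : ball x (ρ - r) ⊆ ball y ρ := ball_subset_ball' (by rw [dist_comm]; linarith)
  calc μ.real (ball y ρ) * c ^ 2 ≤ μ.real (ball x (ρ + r)) * c ^ 2 :=
        mul_le_mul_of_nonneg_right (measureReal_mono houter) (sq_nonneg c)
    _ ≤ Λ * μ.real (ball x (ρ - r)) * c ^ 2 := by gcongr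
    _ = Λ * ((μ.restrict (ball x (ρ - r))).real univ * c ^ 2) := by
        rw [measureReal_restrict_apply_univ, mul_assoc]
    _ ≤ Λ * ∫ z in ball x (ρ - r), (c - f z) ^ 2 ∂μ :=
        mul_le_mul_of_nonneg_left (measureReal_univ_mul_sq_le (hf.restrict _) hmean c) hΛ
    _ ≤ Λ * ∫ z in ball y ρ, (c - f z) ^ 2 ∂μ :=
        mul_le_mul_of_nonneg_left (setIntegral_mono_set
          ((memLp_const c).sub hf).integrable_sq.integrableOn (.of_forall fun z => sq_nonneg _)
          hinner.eventuallyLE) hΛ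

variable [BorelSpace X]

/-- The span in `L²(X, μ)` of the indicators of the balls of radius `s` about the points of `S`.
Its orthogonal complement consists of the functions with mean zero on each of these balls. -/
def ballSpan (μ : Measure X) [IsFiniteMeasure μ] (s : ℝ) (S : Finset X) :
    Submodule ℝ (Lp ℝ 2 μ) :=
  Submodule.span ℝ (range fun x : S =>
    indicatorConstLp 2 (measurableSet_ball (x := (x : X)) (ε := s)) (measure_ne_top μ _) (1 : ℝ))

instance : FiniteDimensional ℝ (ballSpan μ s S) :=
  FiniteDimensional.span_of_finite ℝ (finite_range _)

lemma finrank_ballSpan_le : Module.finrank ℝ (ballSpan μ s S) ≤ S.card :=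
  (finrank_range_le_card _).trans_eq (Fintype.card_coe S)

lemma setIntegral_ball_eq_zero_of_mem_orthogonal {u : Lp ℝ 2 μ} (hu : u ∈ (ballSpan μ s S)ᗮ)
    (hx : x ∈ S) : ∫ z in ball x s, u z ∂μ = 0 := by
  rw [← L2.inner_indicatorConstLp_one measurableSet_ball (measure_ne_top μ _)]
  exact hu _ (Submodule.subset_span ⟨⟨x, hx⟩, rfl⟩)

section SecondCountable

variable [SecondCountableTopology X]

lemma measurableSet_dist_lt (ρ : ℝ) : MeasurableSet {p : X × X | dist p.2 p.1 < ρ} :=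
  measurableSet_lt (measurable_snd.dist measurable_fst) measurable_const

lemma memLp_top_measureReal_ball (μ : Measure X) [IsFiniteMeasure μ] (ρ : ℝ) :
    MemLp (fun x => μ.real (ball x ρ)) ∞ μ :=
  memLp_top_of_bound
    (measurable_measure_prodMk_left (measurableSet_dist_lt ρ)).ennreal_toReal.aestronglyMeasurable
    (μ.real univ) <| .of_forall fun x => by
      rw [Real.norm_of_nonneg measureReal_nonneg]
      exact measureReal_mono (subset_univ _)

/-- The form `(u, v) ↦ ∫ μ(B_ρ(x)) u(x) v(x) dμ(x)` on `L²(X, μ)`, with respect to which the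
`ρ`-Laplacian is symmetric. -/
noncomputable def ballForm (μ : Measure X) [IsFiniteMeasure μ] (ρ : ℝ) :
    Lp ℝ 2 μ →L[ℝ] Lp ℝ 2 μ →L[ℝ] ℝ :=
  weightedForm (memLp_top_measureReal_ball μ ρ)

end SecondCountable

variable [CompactSpace X]

lemma exists_pos_le_measureReal_ball (μ : Measure X) [IsFiniteMeasure μ] (hρ : 0 < ρ) :
    ∃ δ > 0, ∀ᵐ x ∂μ, δ ≤ μ.real (ball x ρ) := by
  obtain ⟨C, hC, hbound⟩ := exists_inv_le μ ρ
  refine ⟨(ρ ^ 2 * (C + 1))⁻¹, by positivity, ?_⟩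
  filter_upwards [hbound, Measure.support_mem_ae (μ := μ)] with x hx hsupp
  have hpos : 0 < μ.real (ball x ρ) := ENNReal.toReal_pos
    ((Measure.mem_support_iff_forall x).1 hsupp _ (ball_mem_nhds x hρ)).ne' (measure_ne_top _ _)
  have hle : (ρ ^ 2 * μ.real (ball x ρ))⁻¹ ≤ C + 1 := hx.trans (by linarith)
  rw [inv_le_comm₀ (by positivity) (by positivity)] at hle
  rwa [mul_inv, inv_mul_le_iff₀ (by positivity)]

lemma isCoercive_ballForm (hρ : 0 < ρ) : IsCoercive (ballForm μ ρ) := by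
  obtain ⟨δ, hδ, hbound⟩ := exists_pos_le_measureReal_ball μ hρ
  exact isCoercive_weightedForm _ hδ hbound

lemma ballForm_rhoLaplacian (u v : Lp ℝ 2 μ) :
    ballForm μ ρ (rhoLaplacian μ ρ u) v = (2 * ρ ^ 2)⁻¹ *
      ∫ p in {p : X × X | dist p.2 p.1 < ρ}, (u p.1 - u p.2) * (v p.1 - v p.2) ∂μ.prod μ := by
  have hswap : Prod.swap ⁻¹' {p : X × X | dist p.2 p.1 < ρ} = {p | dist p.2 p.1 < ρ} :=
    Set.ext fun p => by simp only [mem_preimage, mem_ofPred_eq, Prod.fst_swap, Prod.snd_swap,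
      dist_comm]
  have hint : Integrable (fun p : X × X => (u p.1 - u p.2) * v p.1) (μ.prod μ) :=
    (memLp_fst_sub_snd (Lp.memLp u)).integrable_mul ((Lp.memLp v).comp_fst μ)
  rw [setIntegral_sub_mul_sub hswap (Lp.memLp u) (Lp.memLp v),
    setIntegral_prod_eq_integral_section (measurableSet_dist_lt ρ) hint.integrableOn,
    mul_inv_rev, ballForm, weightedForm_apply, mul_assoc, inv_mul_cancel_left₀ two_ne_zero,
    ← integral_const_mul]
  refine integral_congr_ae ?_
  filter_upwards [rhoLaplacian_coeFn μ ρ u] with x hx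
  rw [hx, ← mul_assoc, measureReal_ball_mul_rhoLapFun, mul_assoc, ← integral_mul_const]
  rfl

lemma ballForm_rhoLaplacian_comm (u v : Lp ℝ 2 μ) :
    ballForm μ ρ (rhoLaplacian μ ρ u) v = ballForm μ ρ u (rhoLaplacian μ ρ v) := by
  rw [ballForm_rhoLaplacian, ballForm, weightedForm_comm, ← ballForm, ballForm_rhoLaplacian]
  simp only [mul_comm (u _ - u _)]

lemma ballForm_self_le (hρ : ρ ≠ 0) (hΛ : 0 < Λ)
    (hnet : ∀ y ∈ μ.support, ∃ x ∈ S, dist y x ≤ r)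
    (hvol : ∀ x ∈ S, μ.real (ball x (ρ + r)) ≤ Λ * μ.real (ball x (ρ - r))) {u : Lp ℝ 2 μ}
    (hu : u ∈ (ballSpan μ (ρ - r) S)ᗮ) :
    (2 * Λ)⁻¹ * ρ⁻¹ ^ 2 * ballForm μ ρ u u ≤ ballForm μ ρ (rhoLaplacian μ ρ u) u := by
  have huu : Integrable (fun x => u x ^ 2) μ := (Lp.memLp u).integrable_sq
  have hint : IntegrableOn (fun p : X × X => (u p.1 - u p.2) ^ 2) {p | dist p.2 p.1 < ρ}
      (μ.prod μ) := (memLp_fst_sub_snd (Lp.memLp u)).integrable_sq.integrableOn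
  have hpoint : ∀ᵐ y ∂μ, μ.real (ball y ρ) * u y ^ 2 ≤
      Λ * ∫ z in ball y ρ, (u y - u z) ^ 2 ∂μ := by
    filter_upwards [Measure.support_mem_ae (μ := μ)] with y hy
    obtain ⟨x, hx, hyx⟩ := hnet y hy
    exact measureReal_ball_mul_sq_le hΛ.le hyx (hvol x hx) (Lp.memLp u)
      (setIntegral_ball_eq_zero_of_mem_orthogonal hu hx) (u y)
  have hpoincare : ballForm μ ρ u u ≤ 2 * Λ * ρ ^ 2 * ballForm μ ρ (rhoLaplacian μ ρ u) u := by
    calc ballForm μ ρ u u = ∫ y, μ.real (ball y ρ) * u y ^ 2 ∂μ := by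
          simp only [ballForm, weightedForm_apply, sq]
      _ ≤ ∫ y, Λ * ∫ z in ball y ρ, (u y - u z) ^ 2 ∂μ ∂μ :=
          integral_mono_ae (huu.mul_of_top_right (memLp_top_measureReal_ball μ ρ))
            ((integrable_setIntegral_section (measurableSet_dist_lt ρ) hint).const_mul Λ) hpoint
      _ = Λ * ∫ p in {p : X × X | dist p.2 p.1 < ρ}, (u p.1 - u p.2) ^ 2 ∂μ.prod μ := by
          rw [integral_const_mul,
            setIntegral_prod_eq_integral_section (measurableSet_dist_lt ρ) hint]
          rfl
      _ = 2 * Λ * ρ ^ 2 * ballForm μ ρ (rhoLaplacian μ ρ u) u := by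
          simp only [ballForm_rhoLaplacian, ← sq]
          field_simp
  rw [inv_pow, ← mul_inv, inv_mul_le_iff₀ (by positivity)]
  exact hpoincare

end BallForm

lemma exists_maximal_separated {X : Type*} [PseudoMetricSpace X] {r : ℝ} (hr : 0 < r)
    (A : Set X) :
    ∃ S ⊆ A, (S.Pairwise fun x y => r ≤ dist x y) ∧ ∀ y ∈ A, ∃ x ∈ S, dist y x < r := by
  obtain ⟨S, hS⟩ := zorn_subset {S : Set X | S ⊆ A ∧ S.Pairwise fun x y => r ≤ dist x y}
    fun c hc hchain => ⟨⋃₀ c, ⟨sUnion_subset fun s hs => (hc hs).1,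
      (pairwise_sUnion hchain.directedOn).2 fun s hs => (hc hs).2⟩,
      fun s hs => subset_sUnion_of_mem hs⟩
  refine ⟨S, hS.prop.1, hS.prop.2, fun y hy => ?_⟩
  by_contra! hfar
  have hins : insert y S ⊆ A ∧ (insert y S).Pairwise fun x y => r ≤ dist x y :=
    ⟨insert_subset hy hS.prop.1, hS.prop.2.insert fun x hx _ =>
      ⟨hfar x hx, (hfar x hx).trans_eq (dist_comm y x)⟩⟩
  have hyS : y ∈ S := hS.le_of_ge hins (subset_insert y S) (mem_insert y S)
  exact hr.not_ge ((hfar y hyS).trans_eq (dist_self y))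

lemma exists_finset_net {X : Type*} [MetricSpace X] {r : ℝ} (hr : 0 < r)
    (hfin : packNumber X r ≠ ⊤) (A : Set X) : ∃ S : Finset X, (S : Set X) ⊆ A ∧
      S.card ≤ packNumber X r ∧ ∀ y ∈ A, ∃ x ∈ S, dist y x < r := by
  obtain ⟨S, hSA, hsep, hnet⟩ := exists_maximal_separated hr A
  have hcard : S.encard ≤ packNumber X r := le_iSup
    (fun S : {S : Set X // S.Pairwise fun x y => r ≤ dist x y} => S.1.encard) ⟨S, hsep⟩
  lift S to Finset X using encard_lt_top_iff.1 (hcard.trans_lt hfin.lt_top)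
  exact ⟨S, hSA, encard_coe_eq_coe_finsetCard S ▸ hcard, hnet⟩

section BIV

variable {X : Type*} [MetricSpace X] [MeasurableSpace X] {μ : Measure X} {Λ s ε : ℝ} {x : X}

lemma BIV.measureReal_ball_le (h : BIV μ Λ s ε) (hΛ : 0 < Λ) (hsε : 0 ≤ s + ε)
    (hx : x ∈ μ.support) : μ.real (ball x (s + ε)) ≤ Λ * μ.real (ball x s) := by
  have hxx := h x hx x hx ((dist_self x).trans_le hsε)
  rwa [inter_self, inv_mul_le_iff₀ hΛ] at hxx

lemma BIV.measureReal_ball_le_of_le [IsFiniteMeasure μ] (h : BIV μ Λ s ε) (hΛ : 0 < Λ)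
    (hsε : 0 ≤ s + ε) (hx : x ∈ μ.support) {r₁ r₂ : ℝ} (hr₁ : s ≤ r₁) (hr₂ : r₂ ≤ s + ε) :
    μ.real (ball x r₂) ≤ Λ * μ.real (ball x r₁) :=
  calc μ.real (ball x r₂) ≤ μ.real (ball x (s + ε)) := measureReal_mono (ball_subset_ball hr₂)
    _ ≤ Λ * μ.real (ball x s) := h.measureReal_ball_le hΛ hsε hx
    _ ≤ Λ * μ.real (ball x r₁) :=
      mul_le_mul_of_nonneg_left (measureReal_mono (ball_subset_ball hr₁)) hΛ.le

end BIV

end MMLaplacian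

theorem theorem7p1_general {X : Type*} [MetricSpace X] [CompactSpace X] [MeasurableSpace X]
    [BorelSpace X] (μ : Measure X) [IsFiniteMeasure μ] {Λ ρ r R : ℝ} (hΛ : 0 < Λ) (hρ : 0 < ρ)
    (hr : 0 < r)
    (hvol : ∀ x ∈ μ.support, μ.real (ball x (ρ + r)) ≤ Λ * μ.real (ball x (ρ - r)))
    (hR : R < (2 * Λ)⁻¹ * ρ⁻¹ ^ 2) :
    MMLaplacian.eigenvalueCount (MMLaplacian.rhoLaplacian μ ρ) R ≤ MMLaplacian.packNumber X r := by
  rcases eq_or_ne (MMLaplacian.packNumber X r) ⊤ with htop | hfin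
  · exact htop ▸ le_top
  obtain ⟨S, hS, hcard, hnet⟩ := MMLaplacian.exists_finset_net hr hfin μ.support
  have hgap := fun u => MMLaplacian.ballForm_self_le (u := u) hρ.ne' hΛ
    (fun y hy => (hnet y hy).imp fun x hx => ⟨hx.1, hx.2.le⟩) fun x hx => hvol x (hS hx)
  calc MMLaplacian.eigenvalueCount (MMLaplacian.rhoLaplacian μ ρ) R
      ≤ Module.finrank ℝ (MMLaplacian.ballSpan μ (ρ - r) S) :=
        MMLaplacian.eigenvalueCount_le_finrank (MMLaplacian.isCoercive_ballForm hρ)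
          MMLaplacian.ballForm_rhoLaplacian_comm hgap hR
    _ ≤ S.card := Nat.cast_le.2 MMLaplacian.finrank_ballSpan_le
    _ ≤ MMLaplacian.packNumber X r := hcard

theorem theorem7p1 (Λ : ℝ) (hΛ : 1 ≤ Λ) :
    ∃ c : ℝ, 0 < c ∧
      ∀ (X : Type*) [MetricSpace X] [CompactSpace X] [MeasurableSpace X] [BorelSpace X]
        (μ : Measure X) [IsFiniteMeasure μ] (ρ : ℝ), 0 < ρ →
        MMLaplacian.BIV μ Λ (5 / 6 * ρ) (5 / 12 * ρ) →
        (∀ x ∈ μ.support, μ.real (ball x (5 * ρ / 3)) ≤ Λ * μ.real (ball x (5 * ρ / 6))) →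
        MMLaplacian.eigenvalueCount (MMLaplacian.rhoLaplacian μ ρ) (c * ρ⁻¹ ^ 2) ≤
          MMLaplacian.packNumber X (ρ / 24) := by
  have hΛ₀ : 0 < Λ := zero_lt_one.trans_le hΛ
  exact ⟨(4 * Λ)⁻¹, by positivity, fun X _ _ _ _ μ _ ρ hρ hBIV _ =>
    theorem7p1_general μ hΛ₀ hρ (by positivity)
      (fun x hx => hBIV.measureReal_ball_le_of_le hΛ₀ (by positivity) hx (by linarith)
        (by linarith))
      (by gcongr; norm_num)⟩
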